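/- Let $1\le k\le n$ be integers. The permanent $\operatorname{per}(M)=\sum_{\sigma\in S_n}\prod_{i=1}^n m_{i\sigma(i)}$ is an infinitely differentiable map from the space $M_n(\mathbb C)$ of $n\times n$ complex matrices to $\mathbb C$. Let $\|X\|$ denote the operator norm of $X\in M_n(\mathbb C)$ induced by the Euclidean norm on $\mathbb C^n$ (the largest singular value of $X$). For $A\in M_n(\mathbb C)$ let $D^k\operatorname{per}A$ be the $k$-th derivative of $\operatorname{per}$ at $A$, regarded as a $k$-linear map $M_n(\mathbb C)\times\cdots\times M_n(\mathbb C)\to\mathbb C$, with the norm $$\|D^k\operatorname{per}A\|=\sup_{\|X^1\|=\cdots=\|X^k\|=1}\bigl|D^k\operatorname{per}A(X^1,\ldots,X^k)\bigr|.$$ Then, for every $A\in M_n(\mathbb C)$, $$\|D^k\operatorname{per}A\|\le k!\binom{n}{k}\|A\|^{n-k},$$ where $\|A\|^0=1$. -/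

import Mathlib

-- Square matrices carry the operator norm induced by the Euclidean norm (the largest singular
-- value), and so do, through it, the spaces of multilinear maps on matrices.
open scoped Matrix.Norms.L2Operator
open scoped ContDiff

/-! The permanent is the diagonal of a symmetric multilinear form, the *mixed permanent*
`(n!)⁻¹ ∑ σ τ, ∏ j, M j (σ j) (τ j)`, and everything rests on the fact that this form has norm at
most one. Indeed, it equals `⟪v, (M 0 ⊗ ⋯ ⊗ M (n - 1)) v⟫`, where `v` is the unit vector
`(n!)^(-1/2) ∑ σ, e (σ 0) ⊗ ⋯ ⊗ e (σ (n - 1))` of the `n`-th tensor power of `ℂⁿ`, and the operator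
norm of a tensor product of matrices is at most the product of the operator norms. This last fact
is `Matrix.sum_norm_sq_tensor_le`, written in coordinates: the tensor power is the space of
functions on multi-indices, with its `ℓ²` norm, and the matrices act on one index at a time.

Given `Matrix.norm_mixedPermanent_le`, the general bound of Mathlib for the derivatives of a
continuous multilinear map gives the factor `n (n - 1) ⋯ (n - k + 1) = k! * (n choose k)`, and
restriction to the diagonal does not increase it, since the diagonal embedding is a linear isometry
into the sup-normed product.
-/

open Finset

namespace Matrix

lemma sum_norm_sq_mulVec_le {m ι : Type*} [Fintype m] [Fintype ι] [DecidableEq ι]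
    (M : Matrix m ι ℂ) (x : ι → ℂ) :
    ∑ a, ‖∑ b, M a b * x b‖ ^ 2 ≤ ‖M‖ ^ 2 * ∑ b, ‖x b‖ ^ 2 := by
  have h := pow_le_pow_left₀ (norm_nonneg _) (l2_opNorm_mulVec M (WithLp.toLp 2 x)) 2
  rw [mul_pow, EuclideanSpace.norm_sq_eq, EuclideanSpace.norm_sq_eq] at h
  simpa [mulVec, dotProduct] using h

/-- The `ℓ²` operator norm of the tensor product of the matrices `M j` is at most the product of
their operator norms. -/
lemma sum_norm_sq_tensor_le {ι : Type*} [Fintype ι] [DecidableEq ι] {m : ℕ}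
    (M : Fin m → Matrix ι ι ℂ) (f : (Fin m → ι) → ℂ) :
    ∑ a : Fin m → ι, ‖∑ b : Fin m → ι, (∏ j, M j (a j) (b j)) * f b‖ ^ 2 ≤
      (∏ j, ‖M j‖) ^ 2 * ∑ b, ‖f b‖ ^ 2 := by
  induction m with
  | zero => simp
  | succ m ih =>
    have split {α : Type} [AddCommMonoid α] (F : (Fin (m + 1) → ι) → α) :
        ∑ a, F a = ∑ i, ∑ a : Fin m → ι, F (Fin.cons i a) := by
      rw [← (Fin.consEquiv fun _ => ι).sum_comp, Fintype.sum_prod_type]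
      rfl
    -- The action of all matrices but the first, with the first index as a parameter.
    set g : ι → (Fin m → ι) → ℂ := fun i a =>
      ∑ b : Fin m → ι, (∏ j, M j.succ (a j) (b j)) * f (Fin.cons i b) with hg
    calc _ = ∑ a : Fin m → ι, ∑ i, ‖∑ i', M 0 i i' * g i' a‖ ^ 2 := by
          rw [split, sum_comm]
          simp only [split, Fin.prod_univ_succ, Fin.cons_zero, Fin.cons_succ, hg, mul_sum,
            mul_assoc]
      _ ≤ ∑ a : Fin m → ι, ‖M 0‖ ^ 2 * ∑ i, ‖g i a‖ ^ 2 :=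
          sum_le_sum fun a _ => sum_norm_sq_mulVec_le (M 0) fun i => g i a
      _ = ‖M 0‖ ^ 2 * ∑ i, ∑ a, ‖g i a‖ ^ 2 := by rw [← mul_sum, sum_comm]
      _ ≤ ‖M 0‖ ^ 2 * ∑ i, (∏ j : Fin m, ‖M j.succ‖) ^ 2 *
            ∑ b : Fin m → ι, ‖f (Fin.cons i b)‖ ^ 2 := by
          gcongr with i
          exact ih (fun j => M j.succ) fun b => f (Fin.cons i b)
      _ = _ := by rw [split, ← mul_sum, Fin.prod_univ_succ, mul_pow, mul_assoc]

/-- The double sum is `⟪w, (M 0 ⊗ ⋯ ⊗ M (n - 1)) w⟫`, where `w = ∑ σ, e (σ 0) ⊗ ⋯ ⊗ e (σ (n - 1))`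
has squared norm `n!`, so the bound is the Cauchy-Schwarz inequality together with
`sum_norm_sq_tensor_le`. -/
lemma norm_sum_perm_perm_le {n : ℕ} (M : Fin n → Matrix (Fin n) (Fin n) ℂ) :
    ‖∑ σ : Equiv.Perm (Fin n), ∑ τ : Equiv.Perm (Fin n), ∏ j, M j (σ j) (τ j)‖ ≤
      n.factorial * ∏ j, ‖M j‖ := by
  let e : Equiv.Perm (Fin n) ↪ (Fin n → Fin n) := ⟨_, DFunLike.coe_injective⟩
  -- The support of `w`, which is its indicator function.
  let S : Finset (Fin n → Fin n) := univ.map e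
  have hS : (#S : ℝ) = n.factorial := by
    simp [S, Fintype.card_perm]
  set T : (Fin n → Fin n) → ℂ := fun a => ∑ b ∈ S, ∏ j, M j (a j) (b j) with hT
  have hT2 : ∑ a, ‖T a‖ ^ 2 ≤ (∏ j, ‖M j‖) ^ 2 * n.factorial := by
    have h := sum_norm_sq_tensor_le M fun b => if b ∈ S then 1 else 0
    have h1 : ∑ b, ‖(if b ∈ S then 1 else 0 : ℂ)‖ ^ 2 = (n.factorial : ℝ) := by
      rw [← hS]
      simp [apply_ite]
    rw [h1] at h
    simpa [hT] using h
  have key : ‖∑ a ∈ S, T a‖ ^ 2 ≤ (n.factorial * ∏ j, ‖M j‖) ^ 2 := by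
    calc ‖∑ a ∈ S, T a‖ ^ 2 ≤ (∑ a ∈ S, ‖T a‖) ^ 2 := by gcongr; exact norm_sum_le _ _
      _ ≤ #S * ∑ a ∈ S, ‖T a‖ ^ 2 := sq_sum_le_card_mul_sum_sq
      _ ≤ #S * ∑ a, ‖T a‖ ^ 2 := by
          gcongr
          exact subset_univ S
      _ ≤ n.factorial * ((∏ j, ‖M j‖) ^ 2 * n.factorial) := by rw [hS]; gcongr
      _ = _ := by ring
  have h := (sq_le_sq₀ (norm_nonneg _)
    (mul_nonneg (Nat.cast_nonneg _) (prod_nonneg fun j _ => norm_nonneg (M j)))).mp key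
  simpa [hT, S, e, sum_map] using h

/-- The multilinear map underlying `mixedPermanent`: the form `(n!)⁻¹ ∑ σ τ, ∏ j, M j (σ j) (τ j)`
in `n` matrices of size `n`. -/
noncomputable def mixedPermanentAux (n : ℕ) :
    MultilinearMap ℂ (fun _ : Fin n => Matrix (Fin n) (Fin n) ℂ) ℂ :=
  (n.factorial : ℂ)⁻¹ • ∑ σ : Equiv.Perm (Fin n), ∑ τ : Equiv.Perm (Fin n),
    (MultilinearMap.mkPiAlgebra ℂ (Fin n) ℂ).compLinearMap
      fun j => entryLinearMap ℂ ℂ (σ j) (τ j)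

lemma mixedPermanentAux_apply {n : ℕ} (M : Fin n → Matrix (Fin n) (Fin n) ℂ) :
    mixedPermanentAux n M = (n.factorial : ℂ)⁻¹ *
      ∑ σ : Equiv.Perm (Fin n), ∑ τ : Equiv.Perm (Fin n), ∏ j, M j (σ j) (τ j) := by
  simp [mixedPermanentAux]

lemma norm_mixedPermanentAux_apply_le {n : ℕ} (M : Fin n → Matrix (Fin n) (Fin n) ℂ) :
    ‖mixedPermanentAux n M‖ ≤ 1 * ∏ j, ‖M j‖ := by
  rw [mixedPermanentAux_apply, norm_mul, norm_inv, RCLike.norm_natCast, one_mul,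
    inv_mul_le_iff₀ (by positivity)]
  exact norm_sum_perm_perm_le M

/-- The mixed permanent of `n` matrices of size `n`, that is, the polarization of the permanent,
as a continuous multilinear map. -/
noncomputable def mixedPermanent (n : ℕ) :
    ContinuousMultilinearMap ℂ (fun _ : Fin n => Matrix (Fin n) (Fin n) ℂ) ℂ :=
  (mixedPermanentAux n).mkContinuous 1 norm_mixedPermanentAux_apply_le

lemma norm_mixedPermanent_le (n : ℕ) : ‖mixedPermanent n‖ ≤ 1 :=
  MultilinearMap.mkContinuous_norm_le _ zero_le_one _

lemma mixedPermanent_diag {n : ℕ} (M : Matrix (Fin n) (Fin n) ℂ) :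
    mixedPermanent n (fun _ => M) = M.permanent := by
  have h (τ : Equiv.Perm (Fin n)) :
      ∑ σ : Equiv.Perm (Fin n), ∏ j, M (σ j) (τ j) = M.permanent := by
    rw [permanent, ← Equiv.sum_comp (Equiv.mulRight τ)]
    exact sum_congr rfl fun σ _ => Equiv.prod_comp τ fun i => M (σ i) i
  change mixedPermanentAux n _ = _
  rw [mixedPermanentAux_apply, sum_comm]
  simp only [h, sum_const, card_univ, Fintype.card_perm, Fintype.card_fin, nsmul_eq_mul]
  exact inv_mul_cancel_left₀ (by exact_mod_cast n.factorial_ne_zero) _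

end Matrix

open Matrix in
/-- The permanent is infinitely differentiable on the `n × n` complex matrices, and its `k`-th
derivative at `A`, with the operator norm of multilinear maps, is bounded by
`k! * (n choose k) * ‖A‖ ^ (n - k)` for `1 ≤ k ≤ n`. -/
theorem theorem2p5 (n k : ℕ) (hk : 1 ≤ k) (hkn : k ≤ n) (A : Matrix (Fin n) (Fin n) ℂ) :
    ContDiff ℂ ∞ (fun M : Matrix (Fin n) (Fin n) ℂ => M.permanent) ∧
      ‖iteratedFDeriv ℂ k (fun M : Matrix (Fin n) (Fin n) ℂ => M.permanent) A‖ ≤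
        (k.factorial : ℝ) * (n.choose k : ℝ) * ‖A‖ ^ (n - k) := by
  have : Nonempty (Fin n) := ⟨⟨0, by omega⟩⟩
  let L : Matrix (Fin n) (Fin n) ℂ →L[ℂ] (Fin n → Matrix (Fin n) (Fin n) ℂ) :=
    ContinuousLinearMap.pi fun _ => ContinuousLinearMap.id ℂ _
  have hL : ‖L‖ ≤ 1 := L.opNorm_le_bound zero_le_one fun M => by
    rw [one_mul]
    exact (pi_norm_const M).le
  have hper : (fun M : Matrix (Fin n) (Fin n) ℂ => M.permanent) = mixedPermanent n ∘ L :=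
    funext fun M => (mixedPermanent_diag M).symm
  have hf : ContDiff ℂ ∞ (mixedPermanent n) := (mixedPermanent n).contDiff
  rw [hper]
  refine ⟨hf.comp L.contDiff, ?_⟩
  rw [L.iteratedFDeriv_comp_right hf A (by exact_mod_cast le_top)]
  have hLA : ‖L A‖ = ‖A‖ := pi_norm_const A
  calc _ ≤ ‖iteratedFDeriv ℂ k (mixedPermanent n) (L A)‖ * ∏ _i : Fin k, ‖L‖ :=
        ContinuousMultilinearMap.norm_compContinuousLinearMap_le _ _
    _ ≤ ‖iteratedFDeriv ℂ k (mixedPermanent n) (L A)‖ * 1 := by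
        gcongr
        exact prod_le_one (fun _ _ => norm_nonneg _) fun _ _ => hL
    _ ≤ n.descFactorial k * ‖mixedPermanent n‖ * ‖L A‖ ^ (n - k) := by
        rw [mul_one]
        simpa using (mixedPermanent n).norm_iteratedFDeriv_le k (L A)
    _ ≤ n.descFactorial k * 1 * ‖L A‖ ^ (n - k) := by
        gcongr
        exact norm_mixedPermanent_le n
    _ = _ := by rw [hLA, mul_one, Nat.descFactorial_eq_factorial_mul_choose, Nat.cast_mul]
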